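/- Let $R$ be a commutative local ring with unit (not necessarily Noetherian). For $f\in R[x]$ let $c(f)$ denote the ideal of $R$ generated by the coefficients of $f$, and suppose that $R$ is Gaussian, i.e. $c(f)c(g)=c(fg)$ for all $f,g\in R[x]$. Suppose further that $R$ is non-reduced, and let $\mathcal{N}$ be its nilradical. If $\mathcal{N}^2=0$, then the weak global dimension of $R$ is infinite: $\operatorname{w.gl.dim}(R)=\infty$. Here $\operatorname{w.gl.dim}(R)=\sup_M \operatorname{wd}_R(M)$ over all $R$-modules $M$, where $\operatorname{wd}_R(M)$ is the minimal $n\ge 0$ for which there is an exact sequence $0\to F_n\to\cdots\to F_1\to F_0\to M\to 0$ with all $F_i$ flat $R$-modules, and $\operatorname{wd}_R(M)=\infty$ if there is no such $n$. -/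

import Mathlib

universe u

open Polynomial

/-- A polynomial `f` over a commutative ring is Gaussian if `c(f) c(g) = c(f g)` for every
polynomial `g`, where `c` denotes the content ideal (generated by the coefficients). -/
def IsGaussianPolynomial {R : Type u} [CommRing R] (f : R[X]) : Prop :=
  ∀ g : R[X], f.contentIdeal * g.contentIdeal = (f * g).contentIdeal

/-- A commutative ring is Gaussian if every polynomial over it is Gaussian. -/
def IsGaussianRing (R : Type u) [CommRing R] : Prop :=
  ∀ f : R[X], IsGaussianPolynomial f

/-- A flat resolution `0 → F n → ⋯ → F 1 → F 0 → M → 0` of length `n`: an exact sequence with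
all `F i` flat. The terms are indexed by all natural numbers, with `F i = 0` for `i > n`. -/
structure FlatResolution (R : Type u) [CommRing R] (M : Type u) [AddCommGroup M] [Module R M]
    (n : ℕ) where
  /-- the terms -/
  F : ℕ → ModuleCat.{u} R
  /-- the differentials `F (i + 1) → F i` -/
  d : ∀ i : ℕ, F (i + 1) →ₗ[R] F i
  /-- the augmentation `F 0 → M` -/
  aug : F 0 →ₗ[R] M
  flat : ∀ i : ℕ, Module.Flat R (F i)
  subsingleton_of_lt : ∀ i : ℕ, n < i → Subsingleton (F i)
  aug_surjective : Function.Surjective aug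
  exact_zero : Function.Exact (d 0) aug
  exact_succ : ∀ i : ℕ, Function.Exact (d (i + 1)) (d i)

/-- The weak (flat) dimension of a module: the minimal length of a flat resolution, and `⊤` if
there is no flat resolution of finite length. -/
noncomputable def weakDim (R : Type u) [CommRing R] (M : Type u) [AddCommGroup M] [Module R M] :
    ℕ∞ :=
  ⨅ (n : ℕ) (_ : Nonempty (FlatResolution R M n)), (n : ℕ∞)

/-- The weak global dimension of a commutative ring: the supremum of the weak dimensions of all
its modules. -/
noncomputable def weakGlobalDim (R : Type u) [CommRing R] : ℕ∞ :=
  ⨆ M : ModuleCat.{u} R, weakDim R M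

/-! Let N be the nilradical and V = R/N. Products of linear polynomials show that N is prime and V
is a valuation domain; since N² = 0, N is a V-module. The claim is that V has no finite flat
resolution over R.

Let A be such a resolution, augmented by A₀ = V, and let C = V ⊗ A. Flatness gives 0 → N ⊗ A_i → A_i
→ C_i → 0 for i ≥ 1, and N ⊗_R A = N ⊗_V C. As A is exact, H_{i+1}(C) is the homology of NA at i.
Descending induction shows that C is exact in all degrees ≥ 2. Suppose that this holds above degree
i, and let B ⊆ Z be the boundaries and cycles of C_i. Then N ⊗ B → N ⊗ Z is bijective. Modules H
with B ⊗ H ≅ Z ⊗ H are closed under tensor products and suitable kernels and cokernels, so M = Z/B,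
being isomorphic to the homology of NA in degree i - 1, is one of them. Thus Tor₁(M, M) = 0 and M ⊗
M = 0, which over a valuation domain forces M = 0 (`ValuationRing.eq_top_of_bijective_rTensor`).

Exactness of C in degree 2 makes N ⊗ A₂ → N ⊗ A₁ surjective, because N kills A₀. Hence N ⊗ V = N
vanishes, a contradiction. -/

/-! ### Local Gaussian rings modulo their nilradical -/

theorem contentIdeal_le_of_coeff_mem {R : Type*} [CommRing R] {f : R[X]} {I : Ideal R}
    (h : ∀ n, f.coeff n ∈ I) : f.contentIdeal ≤ I := by
  rw [contentIdeal_def, Ideal.span_le]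
  intro r hr
  obtain ⟨n, -, rfl⟩ := mem_coeffs_iff.1 (Finset.mem_coe.1 hr)
  exact h n

theorem coeff_linear_mul_linear_mem {R : Type*} [CommRing R] {a b c d : R} {I : Ideal R}
    (h₂ : a * c ∈ I) (h₁ : a * d + b * c ∈ I) (h₀ : b * d ∈ I) (n : ℕ) :
    ((C a * X + C b) * (C c * X + C d)).coeff n ∈ I := by
  have e : (C a * X + C b) * (C c * X + C d) =
      C (a * c) * X ^ 2 + C (a * d + b * c) * X + C (b * d) := by
    simp only [C_mul, C_add]; ring
  rw [e]
  match n with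
  | 0 => simpa using h₀
  | 1 => simpa [-map_mul, coeff_X_pow] using h₁
  | 2 => simpa [-map_mul, coeff_X, coeff_C] using h₂
  | n + 3 => simp [-map_mul, coeff_C_succ]

/-- The product of a coefficient of `a X + b` with one of `c X + d` lies in every ideal containing
the coefficients of the product polynomial. -/
theorem IsGaussianRing.mul_mem_of_linear_mul_linear {R : Type u} [CommRing R]
    (hG : IsGaussianRing R) {a b c d : R} {I : Ideal R}
    (h₂ : a * c ∈ I) (h₁ : a * d + b * c ∈ I) (h₀ : b * d ∈ I) : a * d ∈ I := by
  have key := hG (C a * X + C b) (C c * X + C d)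
  refine contentIdeal_le_of_coeff_mem (coeff_linear_mul_linear_mem h₂ h₁ h₀) (key ▸ ?_)
  have h1 : (C a * X + C b).coeff 1 = a := by simp
  have h0 : (C c * X + C d).coeff 0 = d := by simp
  have m1 := (C a * X + C b).coeff_mem_contentIdeal 1
  have m0 := (C c * X + C d).coeff_mem_contentIdeal 0
  rw [h1] at m1
  rw [h0] at m0
  exact Ideal.mul_mem_mul m1 m0

theorem IsGaussianRing.mul_dvd_of_sq_eq {R : Type u} [CommRing R]
    (hG : IsGaussianRing R) {a b p q : R} (h : b ^ 2 = p * a ^ 2 + q * (a * b)) :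
    a ^ 2 ∣ a * b ∧ a ^ 2 ∣ b ^ 2 := by
  have hab : a * (q * a - b) ∈ Ideal.span {a ^ 2} := by
    -- The factors are aX + b and aX + (qa - b); their product has coefficients a², qa² and -pa².
    apply hG.mul_mem_of_linear_mul_linear (b := b) (c := a)
    · exact Ideal.mem_span_singleton.2 ⟨1, by ring⟩
    · exact Ideal.mem_span_singleton.2 ⟨q, by ring⟩
    · exact Ideal.mem_span_singleton.2 ⟨-p, by linear_combination -h⟩
  obtain ⟨r, hr⟩ := Ideal.mem_span_singleton.1 hab
  have h1 : a * b = a ^ 2 * (q - r) := by linear_combination -hr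
  exact ⟨⟨_, h1⟩, ⟨p + q * (q - r), by rw [h, h1]; ring⟩⟩

/-- In a local Gaussian ring, `(a, b)² = (a²)` or `(a, b)² = (b²)`. -/
theorem IsGaussianRing.sq_dvd_or_sq_dvd {R : Type u} [CommRing R] [IsLocalRing R]
    (hG : IsGaussianRing R) (a b : R) :
    (a ^ 2 ∣ a * b ∧ a ^ 2 ∣ b ^ 2) ∨ (b ^ 2 ∣ b * a ∧ b ^ 2 ∣ a ^ 2) := by
  have h : a * a ∈ Ideal.span {a * b, a ^ 2 + b ^ 2} := by
    -- The factors are aX + b and bX + a.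
    apply hG.mul_mem_of_linear_mul_linear (b := b) (c := b)
    · exact Ideal.subset_span (by simp)
    · exact Ideal.subset_span (by simp [sq])
    · exact Ideal.subset_span (by simp [mul_comm])
  obtain ⟨u, v, h⟩ := Ideal.mem_span_pair.1 h
  -- The relation a² = u·ab + v(a² + b²) can be solved for b² if v is a unit, and for a² if 1 - v
  -- is.
  rcases IsLocalRing.isUnit_or_isUnit_one_sub_self v with hv | hv
  · obtain ⟨w, hw⟩ := hv.exists_left_inv
    exact .inl (hG.mul_dvd_of_sq_eq (p := w * (1 - v)) (q := -(w * u))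
      (by linear_combination w * h - b ^ 2 * hw))
  · obtain ⟨w, hw⟩ := hv.exists_left_inv
    exact .inr (hG.mul_dvd_of_sq_eq (p := w * v) (q := w * u)
      (by linear_combination -w * h - a ^ 2 * hw))

/-- If a² divides b², then b⁴ is a multiple of (ab)². -/
theorem IsGaussianRing.nilradical_isPrime {R : Type u} [CommRing R] [IsLocalRing R]
    (hG : IsGaussianRing R) : (nilradical R).IsPrime := by
  have aux : ∀ {a b : R}, a ^ 2 ∣ b ^ 2 → IsNilpotent (a * b) → IsNilpotent b := by
    rintro a b ⟨c, hc⟩ h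
    have : b ^ 4 = (a * b) * (c * (a * b)) := by linear_combination (b ^ 2) * hc
    exact (IsNilpotent.pow_iff_pos (n := 4) (by norm_num)).1
      (this ▸ (Commute.all _ _).isNilpotent_mul_right h)
  refine Ideal.isPrime_iff.2 ⟨fun h ↦ ?_, fun {a b} h ↦ ?_⟩
  · have : (1 : R) ∈ nilradical R := h ▸ Submodule.mem_top
    exact not_isNilpotent_one (mem_nilradical.1 this)
  · simp only [mem_nilradical] at h ⊢
    rcases hG.sq_dvd_or_sq_dvd a b with ⟨-, hd⟩ | ⟨-, hd⟩
    · exact .inr (aux hd h)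
    · exact .inl (aux hd (by rwa [mul_comm]))

theorem IsGaussianRing.valuationRing_quotient_nilradical {R : Type u} [CommRing R] [IsLocalRing R]
    (hG : IsGaussianRing R) [IsDomain (R ⧸ nilradical R)] : ValuationRing (R ⧸ nilradical R) := by
  have aux : ∀ {a b : R ⧸ nilradical R}, a ^ 2 ∣ a * b ∧ a ^ 2 ∣ b ^ 2 → a ∣ b := by
    rintro a b ⟨⟨r, h1⟩, ⟨s, h2⟩⟩
    rcases eq_or_ne a 0 with rfl | ha
    · have : b = 0 := by simpa using h2
      exact this ▸ dvd_rfl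
    · exact ⟨r, mul_left_cancel₀ ha (by linear_combination h1)⟩
  refine ValuationRing.iff_dvd_total.2 ⟨fun a b ↦ ?_⟩
  obtain ⟨a, rfl⟩ := Ideal.Quotient.mk_surjective a
  obtain ⟨b, rfl⟩ := Ideal.Quotient.mk_surjective b
  have m : ∀ {x y : R}, x ∣ y → Ideal.Quotient.mk (nilradical R) x ∣ Ideal.Quotient.mk _ y :=
    fun h ↦ map_dvd _ h
  rcases hG.sq_dvd_or_sq_dvd a b with ⟨h1, h2⟩ | ⟨h1, h2⟩
  · exact .inl (aux ⟨by simpa using m h1, by simpa using m h2⟩)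
  · exact .inr (aux ⟨by simpa using m h1, by simpa using m h2⟩)

/-! ### Modules H for which φ ⊗ H is bijective -/

open TensorProduct

section Iso

variable {V : Type*} [CommRing V] {B Z : Type*} [AddCommGroup B] [Module V B] [AddCommGroup Z]
  [Module V Z] {φ : B →ₗ[V] Z} {H H' H'' : Type*} [AddCommGroup H] [Module V H] [AddCommGroup H']
  [Module V H'] [AddCommGroup H''] [Module V H'']

theorem rTensor_lTensor_apply (φ : B →ₗ[V] Z) (g : H →ₗ[V] H') (t : B ⊗[V] H) :
    φ.rTensor H' (g.lTensor B t) = g.lTensor Z (φ.rTensor H t) := by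
  rw [← LinearMap.comp_apply, ← LinearMap.comp_apply, LinearMap.rTensor_comp_lTensor,
    LinearMap.lTensor_comp_rTensor]

theorem bijective_rTensor_of_linearEquiv (e : H ≃ₗ[V] H') (h : Function.Bijective (φ.rTensor H)) :
    Function.Bijective (φ.rTensor H') := by
  have : ⇑(φ.rTensor H') ∘ e.lTensor B = e.lTensor Z ∘ φ.rTensor H :=
    funext (rTensor_lTensor_apply φ e.toLinearMap)
  rw [← Function.Bijective.of_comp_iff _ (e.lTensor B).bijective, this]
  exact (e.lTensor Z).bijective.comp h

/-- Flatness of B and Z keeps 0 → ker g → H → H' exact after tensoring; the rest is a diagram chase.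
-/
theorem bijective_rTensor_ker [Module.Flat V B] [Module.Flat V Z] (g : H →ₗ[V] H')
    (h : Function.Bijective (φ.rTensor H)) (h' : Function.Injective (φ.rTensor H')) :
    Function.Bijective (φ.rTensor (LinearMap.ker g)) := by
  have iB : Function.Injective ((LinearMap.ker g).subtype.lTensor B) :=
    Module.Flat.lTensor_preserves_injective_linearMap _ (Submodule.subtype_injective _)
  have iZ : Function.Injective ((LinearMap.ker g).subtype.lTensor Z) :=
    Module.Flat.lTensor_preserves_injective_linearMap _ (Submodule.subtype_injective _)
  have eB := Module.Flat.lTensor_exact B (LinearMap.exact_subtype_ker_map g)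
  have eZ := Module.Flat.lTensor_exact Z (LinearMap.exact_subtype_ker_map g)
  constructor
  · intro s t hst
    apply iB
    apply h.1
    rw [rTensor_lTensor_apply, rTensor_lTensor_apply, hst]
  · intro z
    obtain ⟨b, hb⟩ := h.2 ((LinearMap.ker g).subtype.lTensor Z z)
    have : g.lTensor B b = 0 := by
      apply h'
      rw [rTensor_lTensor_apply, hb, map_zero]
      exact eZ.apply_apply_eq_zero z
    obtain ⟨w, rfl⟩ := (eB b).1 this
    refine ⟨w, iZ ?_⟩
    rw [← hb, rTensor_lTensor_apply]

theorem bijective_rTensor_of_exact {f : H →ₗ[V] H'} {g : H' →ₗ[V] H''}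
    (hfg : Function.Exact f g) (hg : Function.Surjective g)
    (h : Function.Surjective (φ.rTensor H)) (h' : Function.Bijective (φ.rTensor H')) :
    Function.Bijective (φ.rTensor H'') := by
  have eB := lTensor_exact B hfg hg
  have eZ := lTensor_exact Z hfg hg
  have sB := LinearMap.lTensor_surjective B hg
  have sZ := LinearMap.lTensor_surjective Z hg
  constructor
  · refine (injective_iff_map_eq_zero _).2 fun t ht ↦ ?_
    obtain ⟨s, rfl⟩ := sB t
    rw [rTensor_lTensor_apply] at ht
    obtain ⟨r, hr⟩ := (eZ _).1 ht
    obtain ⟨q, rfl⟩ := h r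
    have : f.lTensor B q = s := h'.1 (by rw [rTensor_lTensor_apply, hr])
    exact (eB _).2 ⟨q, this⟩
  · intro z
    obtain ⟨z', rfl⟩ := sZ z
    obtain ⟨b, rfl⟩ := h'.2 z'
    exact ⟨g.lTensor B b, rTensor_lTensor_apply ..⟩

theorem bijective_rTensor_tensorProduct (Q : Type*) [AddCommGroup Q] [Module V Q]
    (h : Function.Bijective (φ.rTensor H)) : Function.Bijective (φ.rTensor (H ⊗[V] Q)) := by
  have e : ⇑(φ.rTensor (H ⊗[V] Q)) ∘ TensorProduct.assoc V B H Q =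
      TensorProduct.assoc V Z H Q ∘ ((LinearEquiv.ofBijective _ h).rTensor Q) := by
    have : φ.rTensor (H ⊗[V] Q) ∘ₗ (TensorProduct.assoc V B H Q).toLinearMap =
      (TensorProduct.assoc V Z H Q).toLinearMap ∘ₗ ((φ.rTensor H).rTensor Q) := by
      ext; rfl
    exact funext fun t ↦ DFunLike.congr_fun this t
  rw [← Function.Bijective.of_comp_iff _ (TensorProduct.assoc V B H Q).bijective, e]
  exact (TensorProduct.assoc V Z H Q).bijective.comp (LinearEquiv.bijective _)

/-- If tensoring with `N` keeps `C₃ → C₂ → C₁ → C₀` exact, the image of the middle map agrees with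
the kernel of the last one after tensoring with `N`. -/
theorem bijective_lTensor_subtype_range_of_exact {C₀ C₁ C₂ C₃ N : Type*} [AddCommGroup C₀]
    [Module V C₀] [AddCommGroup C₁] [Module V C₁] [AddCommGroup C₂] [Module V C₂] [AddCommGroup C₃]
    [Module V C₃] [AddCommGroup N] [Module V N] {f : C₃ →ₗ[V] C₂} {g : C₂ →ₗ[V] C₁}
    {h : C₁ →ₗ[V] C₀}
    (hfg : Function.Exact f g) (hNfg : Function.Exact (f.lTensor N) (g.lTensor N))
    (hNgh : Function.Exact (g.lTensor N) (h.lTensor N)) [Module.Flat V (LinearMap.range h)]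
    (hgh : ∀ x, g x ∈ LinearMap.ker h) :
    Function.Bijective
      ((LinearMap.range (g.codRestrict (LinearMap.ker h) hgh)).subtype.lTensor N) := by
  set g' := g.codRestrict (LinearMap.ker h) hgh
  -- Since range h is flat, Tor₁(N, range h) = 0.
  have inj : Function.Injective ((LinearMap.ker h).subtype.lTensor N) :=
    LinearMap.lTensor_injective_of_exact_of_flat h.rangeRestrict h.surjective_rangeRestrict _
      (Submodule.subtype_injective _)
      (LinearMap.exact_iff.2 (by rw [LinearMap.ker_rangeRestrict, Submodule.range_subtype])) N
  have fac : ∀ s : N ⊗[V] C₂, (LinearMap.ker h).subtype.lTensor N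
      ((LinearMap.range g').subtype.lTensor N (g'.rangeRestrict.lTensor N s)) = g.lTensor N s := by
    intro s
    simp only [← LinearMap.comp_apply, ← LinearMap.lTensor_comp]
    rfl
  have sur := LinearMap.lTensor_surjective N g'.surjective_rangeRestrict
  constructor
  · refine (injective_iff_map_eq_zero _).2 fun t ht ↦ ?_
    obtain ⟨s, rfl⟩ := sur t
    have h0 := fac s
    rw [ht, map_zero] at h0
    obtain ⟨r, rfl⟩ := (hNfg _).1 h0.symm
    rw [← LinearMap.comp_apply, ← LinearMap.lTensor_comp]
    have : g'.rangeRestrict ∘ₗ f = 0 :=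
      LinearMap.ext fun x ↦ Subtype.ext (Subtype.ext (hfg.apply_apply_eq_zero x))
    rw [this, LinearMap.lTensor_zero, LinearMap.zero_apply]
  · intro w
    have : h.lTensor N ((LinearMap.ker h).subtype.lTensor N w) = 0 := by
      rw [← LinearMap.comp_apply, ← LinearMap.lTensor_comp, LinearMap.comp_ker_subtype,
        LinearMap.lTensor_zero, LinearMap.zero_apply]
    obtain ⟨s, hs⟩ := (hNgh _).1 this
    exact ⟨g'.rangeRestrict.lTensor N s, inj (by rw [fac, hs])⟩

theorem bijective_rTensor_of_bijective_lTensor (h : Function.Bijective (φ.lTensor H)) :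
    Function.Bijective (φ.rTensor H) := by
  have : ⇑(φ.rTensor H) ∘ TensorProduct.comm V H B = TensorProduct.comm V H Z ∘ φ.lTensor H := by
    have : φ.rTensor H ∘ₗ (TensorProduct.comm V H B).toLinearMap =
      (TensorProduct.comm V H Z).toLinearMap ∘ₗ φ.lTensor H := by
      ext; rfl
    exact funext fun t ↦ DFunLike.congr_fun this t
  rw [← Function.Bijective.of_comp_iff _ (TensorProduct.comm V H B).bijective, this]
  exact (TensorProduct.comm V H Z).bijective.comp h

end Iso

/-! ### Modules over a valuation domain with Tor₁(M, M) = 0 and M ⊗ M = 0 -/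

section ValuationRing

variable {V : Type*} [CommRing V] [IsDomain V] [ValuationRing V]

theorem ValuationRing.flat_submodule {M : Type*} [AddCommGroup M] [Module V M] [Module.Flat V M]
    (S : Submodule V M) : Module.Flat V S := by
  rw [Module.Flat.flat_iff_torsion_eq_bot_of_isBezout, ← Submodule.isTorsionFree_iff_torsion_eq_bot]
  infer_instance

theorem ValuationRing.exists_smul_eq_of_mem_ideal_smul_top {M : Type*} [AddCommGroup M] [Module V M]
    {J : Ideal V} {x : M} (hx : x ∈ J • (⊤ : Submodule V M)) : ∃ a ∈ J, ∃ m : M, x = a • m := by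
  induction hx using Submodule.smul_induction_on' with
  | smul a ha m _ => exact ⟨a, ha, m, rfl⟩
  | add x _ y _ hx hy =>
    obtain ⟨a, ha, m, rfl⟩ := hx
    obtain ⟨b, hb, n, rfl⟩ := hy
    rcases ValuationRing.dvd_total a b with ⟨c, rfl⟩ | ⟨c, rfl⟩
    · exact ⟨a, ha, m + c • n, by rw [smul_add, smul_smul]⟩
    · exact ⟨b, hb, c • m + n, by rw [smul_add, smul_smul]⟩

/-- Elements outside J divide all elements of J. If st = bc with s, t outside J and b, c in J, then
b = sx and c = ty with xy = 1, so s = by lies in J. -/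
theorem ValuationRing.isPrime_of_forall_exists_mul {J : Ideal V} (hJ : J ≠ ⊤)
    (h : ∀ a ∈ J, ∃ b ∈ J, ∃ c ∈ J, a = b * c) : J.IsPrime := by
  have dvd : ∀ {s b : V}, s ∉ J → b ∈ J → s ∣ b := fun {s b} hs hb ↦
    (ValuationRing.dvd_total s b).resolve_right fun hd ↦ hs (J.mem_of_dvd hd hb)
  refine Ideal.isPrime_iff.2 ⟨hJ, fun {s t} hst ↦ ?_⟩
  by_contra! hcon
  obtain ⟨hs, ht⟩ := hcon
  obtain ⟨b, hb, c, hc, e⟩ := h _ hst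
  obtain ⟨x, rfl⟩ := dvd hs hb
  obtain ⟨y, rfl⟩ := dvd ht hc
  have hs0 : s ≠ 0 := fun h0 ↦ hs (h0 ▸ J.zero_mem)
  have ht0 : t ≠ 0 := fun h0 ↦ ht (h0 ▸ J.zero_mem)
  have hxy : x * y = 1 := mul_left_cancel₀ (mul_ne_zero hs0 ht0) (by linear_combination -e)
  exact hs (by simpa [mul_assoc, hxy] using J.mul_mem_right y hb)

/-- If `Tor₁(M, M) = 0` for `M = Z / B` with `Z` flat, annihilators of elements are idempotent. -/
theorem ValuationRing.exists_mul_of_smul_eq_zero {Z : Type*} [AddCommGroup Z] [Module V Z]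
    [Module.Flat V Z] (B : Submodule V Z) (hB : Function.Injective (B.subtype.rTensor (Z ⧸ B)))
    {y : Z ⧸ B} {a : V} (ha : a • y = 0) :
    ∃ b c : V, b • y = 0 ∧ c • y = 0 ∧ a = b * c := by
  rcases eq_or_ne y 0 with rfl | hy
  · exact ⟨a, 1, by simp, by simp, by simp⟩
  rcases eq_or_ne a 0 with rfl | ha0
  · exact ⟨0, 0, by simp, by simp, by simp⟩
  have := ValuationRing.flat_submodule B
  obtain ⟨z, rfl⟩ := B.mkQ_surjective y
  have hz : a • z ∈ B := (Submodule.Quotient.mk_eq_zero B).1 ha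
  set J : Ideal V := LinearMap.ker (LinearMap.toSpanSingleton V (Z ⧸ B) (B.mkQ z)) with hJ
  let ψ : (V ⧸ J) →ₗ[V] Z ⧸ B := J.liftQ (LinearMap.toSpanSingleton V (Z ⧸ B) (B.mkQ z)) le_rfl
  have hψ : Function.Injective ψ := by
    rw [← LinearMap.ker_eq_bot]
    exact Submodule.ker_liftQ_eq_bot _ _ _ le_rfl
  have hψ' := Module.Flat.lTensor_preserves_injective_linearMap (M := B) ψ hψ
  -- B ⊗ V/J embeds into B ⊗ Z/B and then into Z ⊗ Z/B, where the element becomes z ⊗ ay = 0. Hence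
  -- az lies in JB.
  have h0 : (⟨a • z, hz⟩ : B) ⊗ₜ[V] (Ideal.Quotient.mk J 1) = 0 := by
    apply hψ'
    apply hB
    have : ψ (Ideal.Quotient.mk J 1) = B.mkQ z := by
      change (LinearMap.toSpanSingleton V (Z ⧸ B) (B.mkQ z)) 1 = _
      simp
    rw [LinearMap.lTensor_tmul, LinearMap.rTensor_tmul, this, map_zero, map_zero,
      Submodule.subtype_apply, smul_tmul, ha, tmul_zero]
  have h1 : (⟨a • z, hz⟩ : B) ∈ J • (⊤ : Submodule V B) := by
    have := congrArg (tensorQuotEquivQuotSMul B J) h0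
    rw [map_zero] at this
    rw [← Submodule.Quotient.mk_eq_zero, ← this]
    exact (congrArg _ (one_smul V _).symm)
  obtain ⟨b, hb, m, hm⟩ := ValuationRing.exists_smul_eq_of_mem_ideal_smul_top h1
  replace hm : a • z = b • (m : Z) := congrArg Subtype.val hm
  have hb' : b • B.mkQ z = 0 := by simpa [hJ] using hb
  rcases ValuationRing.dvd_total a b with ⟨c, rfl⟩ | ⟨c, rfl⟩
  · refine absurd ?_ hy
    rw [mul_smul] at hm
    rw [smul_right_injective Z ha0 hm]
    exact (Submodule.Quotient.mk_eq_zero B).2 (B.smul_mem c m.2)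
  · refine ⟨b, c, hb', ?_, rfl⟩
    have hb0 : b ≠ 0 := fun h ↦ ha0 (by simp [h])
    rw [mul_smul] at hm
    have : c • z = m := smul_right_injective Z hb0 hm
    exact (Submodule.Quotient.mk_eq_zero B).2 (show c • z ∈ B from this ▸ m.2)

theorem exists_dual_apply_ne_zero {K W : Type*} [Field K] [AddCommGroup W] [Module K W] {w : W}
    (hw : w ≠ 0) : ∃ g : W →ₗ[K] K, g w ≠ 0 :=
  not_forall.1 (mt (Module.forall_dual_apply_eq_zero_iff K _).1 hw)

theorem ValuationRing.isPrime_ker_toSpanSingleton {M : Type*} [AddCommGroup M] [Module V M]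
    (hidem : ∀ (y : M) (a : V), a • y = 0 → ∃ b c : V, b • y = 0 ∧ c • y = 0 ∧ a = b * c)
    {y : M} (hy : y ≠ 0) : Ideal.IsPrime (LinearMap.ker (LinearMap.toSpanSingleton V M y)) := by
  refine ValuationRing.isPrime_of_forall_exists_mul (fun h ↦ hy ?_) fun a ha ↦ ?_
  · simpa using (Ideal.eq_top_iff_one _).1 h
  · obtain ⟨b, c, hb, hc, e⟩ := hidem y a (by simpa using ha)
    exact ⟨b, by simpa using hb, c, by simpa using hc, e⟩

/-- If ty = am with ay = 0, then a²m = 0; the annihilator of m is prime, so am = 0. -/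
theorem ValuationRing.smul_notMem_smul_top {M : Type*} [AddCommGroup M] [Module V M]
    (hidem : ∀ (y : M) (a : V), a • y = 0 → ∃ b c : V, b • y = 0 ∧ c • y = 0 ∧ a = b * c)
    {y : M} {t : V} (ht : t • y ≠ 0) :
    t • y ∉ LinearMap.ker (LinearMap.toSpanSingleton V M y) • (⊤ : Submodule V M) := by
  intro h
  obtain ⟨a, ha, m, hm⟩ := ValuationRing.exists_smul_eq_of_mem_ideal_smul_top h
  have hm0 : m ≠ 0 := by
    rintro rfl
    exact ht (by simpa using hm)
  have ha' : a • y = 0 := by simpa using ha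
  have h2 : (a * a) • m = 0 := by rw [mul_smul, ← hm, smul_comm, ha', smul_zero]
  have h3 : a • m = 0 := by
    have := (ValuationRing.isPrime_ker_toSpanSingleton hidem hm0).mem_or_mem (x := a) (y := a)
      (by simpa using h2)
    simpa using this
  exact ht (hm.trans h3)

/-- A nonzero module over a valuation domain whose element annihilators are all idempotent has
nonzero tensor square. -/
theorem ValuationRing.not_subsingleton_tensorProduct_self {M : Type*} [AddCommGroup M] [Module V M]
    (hidem : ∀ (y : M) (a : V), a • y = 0 → ∃ b c : V, b • y = 0 ∧ c • y = 0 ∧ a = b * c)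
    [Nontrivial M] : ¬ Subsingleton (M ⊗[V] M) := by
  obtain ⟨y, hy⟩ := exists_ne (0 : M)
  set J : Ideal V := LinearMap.ker (LinearMap.toSpanSingleton V M y) with hJ
  have hJp : J.IsPrime := ValuationRing.isPrime_ker_toSpanSingleton hidem hy
  let A := V ⧸ J
  let K := FractionRing A
  let Q := M ⧸ (J • (⊤ : Submodule V M))
  let q : Q := Submodule.Quotient.mk y
  -- The class of y survives in the generic fibre of M/JM over V/J. A functional f with f(y) ≠ 0
  -- then gives a map M ⊗ M → K taking y ⊗ y to f(y)² ≠ 0.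
  have hq : (1 : K) ⊗ₜ[A] q ≠ 0 := by
    intro h0
    obtain ⟨⟨s, hs⟩, hsq⟩ := (IsLocalizedModule.eq_zero_iff (nonZeroDivisors A)
      (TensorProduct.mk A K Q 1) (m := q)).1 h0
    obtain ⟨t, rfl⟩ := Ideal.Quotient.mk_surjective s
    have ht : t • y ≠ 0 := fun h ↦ nonZeroDivisors.ne_zero hs
      (Ideal.Quotient.eq_zero_iff_mem.2 (by simpa [hJ] using h))
    refine ValuationRing.smul_notMem_smul_top hidem ht ?_
    rw [← Submodule.Quotient.mk_eq_zero]
    exact hsq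
  obtain ⟨g, hg⟩ := exists_dual_apply_ne_zero (K := K) hq
  let f : M →ₗ[V] K := (g.restrictScalars V) ∘ₗ ((TensorProduct.mk A K Q 1).restrictScalars V) ∘ₗ
    (J • (⊤ : Submodule V M)).mkQ
  intro _
  have h0 : TensorProduct.lift ((LinearMap.mul V K).compl₁₂ f f) (y ⊗ₜ y) = 0 := by
    rw [Subsingleton.elim (y ⊗ₜ[V] y) 0, map_zero]
  exact hg (mul_self_eq_zero.1 h0)

theorem ValuationRing.eq_top_of_bijective_rTensor {Z : Type*} [AddCommGroup Z] [Module V Z]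
    [Module.Flat V Z] (B : Submodule V Z) (hB : Function.Bijective (B.subtype.rTensor (Z ⧸ B))) :
    B = ⊤ := by
  by_contra hne
  have : Nontrivial (Z ⧸ B) := Submodule.Quotient.nontrivial_iff.2 hne
  refine ValuationRing.not_subsingleton_tensorProduct_self (M := Z ⧸ B)
    (fun y a ha ↦ ValuationRing.exists_mul_of_smul_eq_zero B hB.1 ha) ?_
  refine subsingleton_of_forall_eq 0 fun t ↦ ?_
  obtain ⟨s, rfl⟩ := LinearMap.rTensor_surjective (Z ⧸ B) B.mkQ_surjective t
  obtain ⟨r, rfl⟩ := hB.2 s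
  exact (rTensor_exact (Z ⧸ B) (LinearMap.exact_subtype_mkQ B)
    B.mkQ_surjective).apply_apply_eq_zero r

end ValuationRing

/-! ### The action map N ⊗ X → X and base change to V -/

section SquareZero

variable {R V N : Type*} [CommRing R] [CommRing V] [Algebra R V] [AddCommGroup N] [Module R N]
  {X Y : Type*} [AddCommGroup X] [Module R X] [AddCommGroup Y]
  [Module R Y]

/-- The map `N ⊗ X → X` induced by a linear map `N → R`. -/
noncomputable def tensorAct (j : N →ₗ[R] R) (X : Type*) [AddCommGroup X] [Module R X] :
    N ⊗[R] X →ₗ[R] X :=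
  (TensorProduct.lid R X).toLinearMap ∘ₗ j.rTensor X

@[simp]
theorem tensorAct_tmul (j : N →ₗ[R] R) (n : N) (x : X) : tensorAct j X (n ⊗ₜ x) = j n • x := by
  simp [tensorAct]

theorem tensorAct_injective {j : N →ₗ[R] R} (hj : Function.Injective j) [Module.Flat R X] :
    Function.Injective (tensorAct j X) :=
  (TensorProduct.lid R X).injective.comp
    (Module.Flat.rTensor_preserves_injective_linearMap (M := X) j hj)

theorem map_tensorAct [Module V N] [IsScalarTower R V N] (j : N →ₗ[R] R) (f : X →ₗ[R] Y)
    (w : N ⊗[R] X) :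
    f (tensorAct j X w) = tensorAct j Y (AlgebraTensorModule.lTensor V N f w) := by
  induction w with
  | zero => simp
  | tmul n x => simp
  | add x y hx hy => rw [map_add, map_add, hx, hy, map_add, map_add]

theorem exact_tensorAct_mk {j : N →ₗ[R] R} (hj : Function.Exact j (Algebra.linearMap R V))
    (hV : Function.Surjective (algebraMap R V)) (X : Type*) [AddCommGroup X] [Module R X] :
    Function.Exact (tensorAct j X) (TensorProduct.mk R V X 1) := by
  have h := rTensor_exact X hj hV
  have e : ∀ x : X, TensorProduct.mk R V X 1 x =
      (Algebra.linearMap R V).rTensor X ((TensorProduct.lid R X).symm x) := by simp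
  intro x
  rw [e, h]
  constructor
  · rintro ⟨w, hw⟩
    exact ⟨w, by simp [tensorAct, hw]⟩
  · rintro ⟨w, hw⟩
    exact ⟨w, by simp [← hw, tensorAct]⟩

theorem baseChange_mk_one (f : X →ₗ[R] Y) (x : X) :
    f.baseChange V (TensorProduct.mk R V X 1 x) = TensorProduct.mk R V Y 1 (f x) := rfl

/-- Naturality of N ⊗_V (V ⊗_R X) ≅ N ⊗_R X, which identifies the complexes N ⊗_V C and N ⊗_R A. -/
theorem cancelBaseChange_lTensor_baseChange [Module V N] [IsScalarTower R V N] (f : X →ₗ[R] Y)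
    (t : N ⊗[V] (V ⊗[R] X)) :
    AlgebraTensorModule.cancelBaseChange R V V N Y ((f.baseChange V).lTensor N t) =
      AlgebraTensorModule.lTensor V N f (AlgebraTensorModule.cancelBaseChange R V V N X t) := by
  induction t with
  | zero => simp
  | add x y hx hy => simp only [map_add, hx, hy]
  | tmul n c =>
    induction c with
    | zero => simp
    | add x y hx hy => simp only [map_add, tmul_add, hx, hy]
    | tmul v x => simp

theorem exact_lTensor_baseChange [Module V N] [IsScalarTower R V N] {X' : Type*} [AddCommGroup X']
    [Module R X'] {f : X' →ₗ[R] X} {g : X →ₗ[R] Y}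
    (h : Function.Exact (AlgebraTensorModule.lTensor V N f) (AlgebraTensorModule.lTensor V N g)) :
    Function.Exact ((f.baseChange V).lTensor N) ((g.baseChange V).lTensor N) := by
  intro t
  rw [← (AlgebraTensorModule.cancelBaseChange R V V N Y).map_eq_zero_iff,
    cancelBaseChange_lTensor_baseChange, h]
  constructor
  · rintro ⟨s, hs⟩
    refine ⟨(AlgebraTensorModule.cancelBaseChange R V V N X').symm s,
      (AlgebraTensorModule.cancelBaseChange R V V N X).injective ?_⟩
    rw [cancelBaseChange_lTensor_baseChange, LinearEquiv.apply_symm_apply, hs]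
  · rintro ⟨s, rfl⟩
    exact ⟨_, (cancelBaseChange_lTensor_baseChange f s).symm⟩

/-- Two surjections with the same kernel have isomorphic targets. -/
theorem nonempty_linearEquiv_of_ker_eq {P P₁ P₂ : Type*} [AddCommGroup P] [Module R P]
    [AddCommGroup P₁] [Module R P₁] [AddCommGroup P₂] [Module R P₂] [Module V P₁] [Module V P₂]
    [IsScalarTower R V P₁] [IsScalarTower R V P₂] (hV : Function.Surjective (algebraMap R V))
    {p : P →ₗ[R] P₁} {q : P →ₗ[R] P₂} (hp : Function.Surjective p) (hq : Function.Surjective q)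
    (h : LinearMap.ker p = LinearMap.ker q) : Nonempty (P₁ ≃ₗ[V] P₂) :=
  ⟨((p.quotKerEquivOfSurjective hp).symm ≪≫ₗ Submodule.quotEquivOfEq _ _ h ≪≫ₗ
    q.quotKerEquivOfSurjective hq).extendScalarsOfSurjective hV⟩

end SquareZero

/-! ### Descending induction on the exactness of C = V ⊗ A -/

section Complex

variable {R V N : Type*} [CommRing R] [CommRing V] [Algebra R V] [AddCommGroup N] [Module R N]
  [Module V N] [IsScalarTower R V N] {A : ℕ → Type*} [∀ i, AddCommGroup (A i)]
  [∀ i, Module R (A i)] {δ : ∀ i, A (i + 1) →ₗ[R] A i} {j : N →ₗ[R] R}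

/-- This is the vanishing of the connecting map from degree m + 2 of C. The cycle condition is
imposed in A m, not in N ⊗ A m, since A 0 need not be flat. -/
theorem mem_range_lTensor_of_exact_baseChange (hj : Function.Injective j)
    (hjV : Function.Exact j (Algebra.linearMap R V)) (hV : Function.Surjective (algebraMap R V))
    (hδ : ∀ i, Function.Exact (δ (i + 1)) (δ i)) [∀ i, Module.Flat R (A (i + 1))] (m : ℕ)
    (hC : Function.Exact ((δ (m + 2)).baseChange V) ((δ (m + 1)).baseChange V))
    {w : N ⊗[R] A (m + 1)} (hw : δ m (tensorAct j _ w) = 0) :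
    ∃ w', AlgebraTensorModule.lTensor V N (δ (m + 1)) w' = w := by
  obtain ⟨a, ha⟩ := (hδ m _).1 hw
  have h0 : (δ (m + 1)).baseChange V (TensorProduct.mk R V _ 1 a) = 0 := by
    rw [baseChange_mk_one, ha]
    exact (exact_tensorAct_mk hjV hV _).apply_apply_eq_zero w
  obtain ⟨c, hc⟩ := (hC _).1 h0
  obtain ⟨a', rfl⟩ := TensorProduct.mk_surjective R (A (m + 3)) V hV c
  rw [baseChange_mk_one] at hc
  obtain ⟨w', hw'⟩ := (exact_tensorAct_mk hjV hV _ (a - δ (m + 2) a')).1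
    (by rw [map_sub, hc, sub_self])
  refine ⟨w', tensorAct_injective hj ?_⟩
  rw [← map_tensorAct, hw', map_sub, ha, (hδ (m + 1)).apply_apply_eq_zero, sub_zero]

theorem exact_lTensor_of_exact_baseChange (hj : Function.Injective j)
    (hjV : Function.Exact j (Algebra.linearMap R V)) (hV : Function.Surjective (algebraMap R V))
    (hδ : ∀ i, Function.Exact (δ (i + 1)) (δ i)) [∀ i, Module.Flat R (A (i + 1))] (m : ℕ)
    (hC : Function.Exact ((δ (m + 2)).baseChange V) ((δ (m + 1)).baseChange V)) :
    Function.Exact (AlgebraTensorModule.lTensor V N (δ (m + 1)))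
      (AlgebraTensorModule.lTensor V N (δ m)) := by
  refine fun w ↦ ⟨fun hw ↦ mem_range_lTensor_of_exact_baseChange hj hjV hV hδ m hC ?_, ?_⟩
  · rw [map_tensorAct (V := V), hw, map_zero]
  · rintro ⟨w', rfl⟩
    rw [← LinearMap.comp_apply, ← AlgebraTensorModule.lTensor_comp,
      (hδ m).linearMap_comp_eq_zero]
    simp

/-- The connecting isomorphism `Hₖ₊₂(C) ≃ Hₖ₊₁(N ⊗ A)` for `C = A / (N ⊗ A)`. Here `W` is the module
of cycles of `N ⊗ A` and `Z` that of `C`. -/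
theorem nonempty_connecting_linearEquiv (hj : Function.Injective j)
    (hV : Function.Surjective (algebraMap R V))
    (hδ : ∀ i, Function.Exact (δ (i + 1)) (δ i)) [∀ i, Module.Flat R (A (i + 1))] (k : ℕ)
    {C₁ C₂ : Type*} [AddCommGroup C₁] [Module R C₁] [Module V C₁] [IsScalarTower R V C₁]
    [AddCommGroup C₂] [Module R C₂] [Module V C₂]
    {π₁ : A (k + 2) →ₗ[R] C₁} (hπ₁ : Function.Surjective π₁)
    (hjπ : Function.Exact (tensorAct j (A (k + 2))) π₁)
    {π₂ : A (k + 3) →ₗ[R] C₂} (hπ₂ : Function.Surjective π₂)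
    {g : C₂ →ₗ[V] C₁} (hg : ∀ a, g (π₂ a) = π₁ (δ (k + 2) a))
    (W : Submodule V (N ⊗[R] A (k + 1))) (hW : ∀ w, w ∈ W ↔ δ k (tensorAct j _ w) = 0)
    (Z : Submodule V C₁)
    (hZ : ∀ a, π₁ a ∈ Z ↔ δ (k + 1) a ∈ LinearMap.range (tensorAct j (A (k + 1))))
    (hC : ∀ x, g x ∈ Z) (hE : ∀ x, AlgebraTensorModule.lTensor V N (δ (k + 1)) x ∈ W) :
    Nonempty ((W ⧸ LinearMap.range ((AlgebraTensorModule.lTensor V N (δ (k + 1))).codRestrict W hE))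
      ≃ₗ[V] (Z ⧸ LinearMap.range (g.codRestrict Z hC))) := by
  let e := LinearEquiv.ofInjective _ (tensorAct_injective (X := A (k + 1)) hj)
  -- P consists of the a with δa in N·A (k + 1). It surjects onto both quotients, with the same
  -- kernel N·A (k + 2) + δ(A (k + 3)).
  let P : Submodule R (A (k + 2)) := (Z.restrictScalars R).comap π₁
  have hP : ∀ a : P, δ (k + 1) a ∈ LinearMap.range (tensorAct j (A (k + 1))) := fun a ↦
    (hZ _).1 a.2
  let q₀ : P →ₗ[R] N ⊗[R] A (k + 1) :=
    e.symm.toLinearMap ∘ₗ (δ (k + 1) ∘ₗ P.subtype).codRestrict _ hP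
  have hq₀ : ∀ a : P, tensorAct j _ (q₀ a) = δ (k + 1) a := fun a ↦
    congrArg Subtype.val (e.apply_symm_apply ⟨_, hP a⟩)
  let q : P →ₗ[R] W := q₀.codRestrict (W.restrictScalars R) fun a ↦
    (hW _).2 (by rw [hq₀, (hδ k).apply_apply_eq_zero])
  let p : P →ₗ[R] Z := (π₁ ∘ₗ P.subtype).codRestrict (Z.restrictScalars R) fun a ↦ a.2
  have hp : Function.Surjective p := by
    rintro ⟨c, hc⟩
    obtain ⟨a, rfl⟩ := hπ₁ c
    exact ⟨⟨a, hc⟩, rfl⟩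
  have hq : Function.Surjective q := by
    rintro ⟨w, hw⟩
    obtain ⟨a, ha⟩ := (hδ k _).1 ((hW w).1 hw)
    have haP : a ∈ P := (hZ _).2 ⟨w, ha.symm⟩
    exact ⟨⟨a, haP⟩, Subtype.ext (tensorAct_injective hj ((hq₀ ⟨a, haP⟩).trans ha))⟩
  refine nonempty_linearEquiv_of_ker_eq hV
    (p := (LinearMap.range ((AlgebraTensorModule.lTensor V N (δ (k + 1))).codRestrict W
      hE)).mkQ.restrictScalars R ∘ₗ q)
    (q := (LinearMap.range (g.codRestrict Z hC)).mkQ.restrictScalars R ∘ₗ p)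
    ((Submodule.mkQ_surjective _).comp hq) ((Submodule.mkQ_surjective _).comp hp) ?_
  ext a
  rw [LinearMap.mem_ker, LinearMap.mem_ker]
  have h1 : q a ∈
      LinearMap.range ((AlgebraTensorModule.lTensor V N (δ (k + 1))).codRestrict W hE) ↔
      ∃ w a', (a : A (k + 2)) = tensorAct j _ w + δ (k + 2) a' := by
    constructor
    · rintro ⟨w, hw⟩
      have hw' : AlgebraTensorModule.lTensor V N (δ (k + 1)) w = q₀ a := congrArg Subtype.val hw
      obtain ⟨a', ha'⟩ := (hδ (k + 1) (a - tensorAct j _ w)).1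
        (by rw [map_sub, map_tensorAct (V := V), hw', hq₀, sub_self])
      exact ⟨w, a', by rw [ha', add_sub_cancel]⟩
    · rintro ⟨w, a', h⟩
      refine ⟨w, Subtype.ext (tensorAct_injective hj ?_)⟩
      refine Eq.trans ?_ (hq₀ a).symm
      rw [h, map_add, (hδ (k + 1)).apply_apply_eq_zero, add_zero, map_tensorAct (V := V)]
      rfl
  have h2 : p a ∈ LinearMap.range (g.codRestrict Z hC) ↔
      ∃ w a', (a : A (k + 2)) = tensorAct j _ w + δ (k + 2) a' := by
    constructor
    · rintro ⟨c, hc⟩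
      obtain ⟨a', rfl⟩ := hπ₂ c
      have hc' : π₁ (δ (k + 2) a') = π₁ a := (hg a').symm.trans (congrArg Subtype.val hc)
      obtain ⟨w, hw⟩ := (hjπ (a - δ (k + 2) a')).1 (by rw [map_sub, sub_eq_zero, hc'])
      exact ⟨w, a', by rw [hw, sub_add_cancel]⟩
    · rintro ⟨w, a', h⟩
      refine ⟨π₂ a', Subtype.ext ((hg a').trans ?_)⟩
      change π₁ (δ (k + 2) a') = π₁ a
      rw [h, map_add, hjπ.apply_apply_eq_zero, zero_add]
  exact (Submodule.Quotient.mk_eq_zero _).trans (h1.trans (h2.symm.trans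
    (Submodule.Quotient.mk_eq_zero _).symm))

/-- For the cycles `W` of `N ⊗ A` in positive degrees: tensoring `φ` with `W` is bijective as soon
as tensoring it with `N` is. -/
theorem exists_cycles_bijective_rTensor {B Z : Type*} [AddCommGroup B] [Module V B]
    [AddCommGroup Z] [Module V Z] [Module.Flat V B] [Module.Flat V Z] {φ : B →ₗ[V] Z}
    (hN : Function.Bijective (φ.rTensor N)) (hj : Function.Injective j)
    [∀ i, Module.Flat R (A (i + 1))] (h0 : ∀ n (x : A 0), j n • x = 0) (k : ℕ) :
    ∃ W : Submodule V (N ⊗[R] A (k + 1)), (∀ w, w ∈ W ↔ δ k (tensorAct j _ w) = 0) ∧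
      Function.Bijective (φ.rTensor W) := by
  have hE : ∀ i, Function.Bijective (φ.rTensor (N ⊗[R] A i)) := fun i ↦
    bijective_rTensor_of_linearEquiv (AlgebraTensorModule.cancelBaseChange R V V N (A i))
      (bijective_rTensor_tensorProduct _ hN)
  cases k with
  | zero =>
    -- N kills A 0, so everything in degree 1 is a cycle.
    refine ⟨⊤, fun w ↦ ⟨fun _ ↦ ?_, fun _ ↦ trivial⟩,
      bijective_rTensor_of_linearEquiv Submodule.topEquiv.symm (hE 1)⟩
    induction w with
    | zero => simp
    | tmul n x => simp [h0]
    | add x y hx hy => rw [map_add, map_add, hx trivial, hy trivial, add_zero]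
  | succ k =>
    refine ⟨LinearMap.ker (AlgebraTensorModule.lTensor V N (δ (k + 1))), fun w ↦ ?_,
      bijective_rTensor_ker _ (hE _) (hE _).1⟩
    rw [map_tensorAct (V := V), map_eq_zero_iff _ (tensorAct_injective hj), LinearMap.mem_ker]

variable [IsDomain V] [ValuationRing V]

/-- If `C₃ → C₂ → C₁ → C₀` is part of the complex `A / (N ⊗ A)`, and if it is exact at `C₂` and stays
exact at `C₂` and `C₁` after tensoring with `N`, then it is exact at `C₁`. -/
theorem exact_of_exact_lTensor (hj : Function.Injective j)
    (hV : Function.Surjective (algebraMap R V))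
    (hδ : ∀ i, Function.Exact (δ (i + 1)) (δ i)) [∀ i, Module.Flat R (A (i + 1))]
    (h0 : ∀ n (x : A 0), j n • x = 0) (k : ℕ)
    {C₀ C₁ C₂ C₃ : Type*} [AddCommGroup C₀] [Module V C₀] [Module.Flat V C₀]
    [AddCommGroup C₁] [Module R C₁] [Module V C₁] [IsScalarTower R V C₁] [Module.Flat V C₁]
    [AddCommGroup C₂] [Module R C₂] [Module V C₂] [AddCommGroup C₃] [Module V C₃]
    {π₁ : A (k + 2) →ₗ[R] C₁} (hπ₁ : Function.Surjective π₁)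
    (hjπ : Function.Exact (tensorAct j (A (k + 2))) π₁)
    {π₂ : A (k + 3) →ₗ[R] C₂} (hπ₂ : Function.Surjective π₂)
    {f : C₃ →ₗ[V] C₂} {g : C₂ →ₗ[V] C₁} {h : C₁ →ₗ[V] C₀}
    (hg : ∀ a, g (π₂ a) = π₁ (δ (k + 2) a))
    (hh : ∀ a, h (π₁ a) = 0 ↔ δ (k + 1) a ∈ LinearMap.range (tensorAct j (A (k + 1))))
    (hgh : ∀ x, h (g x) = 0) (hfg : Function.Exact f g)
    (hNfg : Function.Exact (f.lTensor N) (g.lTensor N))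
    (hNgh : Function.Exact (g.lTensor N) (h.lTensor N)) : Function.Exact g h := by
  have := ValuationRing.flat_submodule (LinearMap.range h)
  let Z : Submodule V C₁ := LinearMap.ker h
  have hZf : Module.Flat V Z := ValuationRing.flat_submodule Z
  let B : Submodule V Z := LinearMap.range (g.codRestrict Z hgh)
  have hBf : Module.Flat V B := ValuationRing.flat_submodule B
  have hN : Function.Bijective (B.subtype.rTensor N) :=
    bijective_rTensor_of_bijective_lTensor
      (bijective_lTensor_subtype_range_of_exact hfg hNfg hNgh hgh)
  obtain ⟨W, hW, hWb⟩ := exists_cycles_bijective_rTensor (A := A) (δ := δ) hN hj h0 k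
  have hE : ∀ x, AlgebraTensorModule.lTensor V N (δ (k + 1)) x ∈ W := fun x ↦ by
    rw [hW, ← map_tensorAct, (hδ k).apply_apply_eq_zero]
  obtain ⟨e⟩ := nonempty_connecting_linearEquiv hj hV hδ k hπ₁ hjπ hπ₂ hg W hW Z hh hgh hE
  -- Z/B is the cokernel of N ⊗ A (k + 2) → W, and both of these modules have the bijectivity
  -- property.
  have hM : Function.Bijective (B.subtype.rTensor (Z ⧸ B)) := by
    refine bijective_rTensor_of_linearEquiv e (bijective_rTensor_of_exact
      (f := (AlgebraTensorModule.lTensor V N (δ (k + 1))).codRestrict W hE)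
      (LinearMap.exact_map_mkQ_range _) (Submodule.mkQ_surjective _) ?_ hWb)
    exact (bijective_rTensor_of_linearEquiv (AlgebraTensorModule.cancelBaseChange R V V N _)
      (bijective_rTensor_tensorProduct _ hN)).2
  have htop := ValuationRing.eq_top_of_bijective_rTensor B hM
  refine fun c ↦ ⟨fun hc ↦ ?_, ?_⟩
  · obtain ⟨x, hx⟩ : (⟨c, hc⟩ : Z) ∈ B := htop ▸ Submodule.mem_top
    exact ⟨x, congrArg Subtype.val hx⟩
  · rintro ⟨x, rfl⟩
    exact hgh x

theorem exact_baseChange_of_exact_succ (hj : Function.Injective j)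
    (hjV : Function.Exact j (Algebra.linearMap R V)) (hV : Function.Surjective (algebraMap R V))
    (hδ : ∀ i, Function.Exact (δ (i + 1)) (δ i)) [∀ i, Module.Flat R (A (i + 1))]
    (h0 : ∀ n (x : A 0), j n • x = 0) (k : ℕ)
    (h₁ : Function.Exact ((δ (k + 3)).baseChange V) ((δ (k + 2)).baseChange V))
    (h₂ : Function.Exact ((δ (k + 4)).baseChange V) ((δ (k + 3)).baseChange V)) :
    Function.Exact ((δ (k + 2)).baseChange V) ((δ (k + 1)).baseChange V) := by
  have hC : ∀ x, (δ (k + 1)).baseChange V ((δ (k + 2)).baseChange V x) = 0 := by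
    intro x
    obtain ⟨a, rfl⟩ := TensorProduct.mk_surjective R (A (k + 3)) V hV x
    rw [baseChange_mk_one, baseChange_mk_one, (hδ (k + 1)).apply_apply_eq_zero, map_zero]
  exact exact_of_exact_lTensor hj hV hδ h0 k
    (TensorProduct.mk_surjective R _ V hV) (exact_tensorAct_mk hjV hV _)
    (TensorProduct.mk_surjective R _ V hV) (fun a ↦ rfl)
    (fun a ↦ exact_tensorAct_mk hjV hV _ (δ (k + 1) a)) hC h₁
    (exact_lTensor_baseChange (exact_lTensor_of_exact_baseChange hj hjV hV hδ (k + 2) h₂))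
    (exact_lTensor_baseChange (exact_lTensor_of_exact_baseChange hj hjV hV hδ (k + 1) h₁))

theorem subsingleton_tensor_of_bounded_resolution (hj : Function.Injective j)
    (hjV : Function.Exact j (Algebra.linearMap R V)) (hV : Function.Surjective (algebraMap R V))
    (hδ : ∀ i, Function.Exact (δ (i + 1)) (δ i)) (hδ0 : Function.Surjective (δ 0))
    [∀ i, Module.Flat R (A (i + 1))]
    (h0 : ∀ n (x : A 0), j n • x = 0) (m : ℕ) (hm : ∀ i, m < i → Subsingleton (A i)) :
    Subsingleton (N ⊗[R] A 0) := by
  -- Exactness of C in degree k + 2, by induction on a bound s for the distance to the vanishing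
  -- range; a step needs the next two degrees.
  have key : ∀ s k, m < k + 2 + s →
      Function.Exact ((δ (k + 2)).baseChange V) ((δ (k + 1)).baseChange V) := by
    intro s
    induction s with
    | zero =>
      intro k hk
      have := hm (k + 2) hk
      have : Subsingleton (V ⊗[R] A (k + 2)) :=
        (TensorProduct.mk_surjective R (A (k + 2)) V hV).subsingleton
      exact fun c ↦ ⟨fun _ ↦ ⟨0, Subsingleton.elim _ _⟩,
        fun _ ↦ by rw [Subsingleton.elim c 0, map_zero]⟩
    | succ s ih =>
      intro k hk
      exact exact_baseChange_of_exact_succ hj hjV hV hδ h0 k (ih (k + 1) (by omega))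
        (ih (k + 2) (by omega))
  refine subsingleton_of_forall_eq 0 fun t ↦ ?_
  obtain ⟨w, rfl⟩ := LinearMap.lTensor_surjective N hδ0 t
  have hw : δ 0 (tensorAct j _ w) = 0 := by
    induction w with
    | zero => simp
    | tmul n x => simp [h0]
    | add x y hx hy => rw [map_add, map_add, hx, hy, add_zero]
  obtain ⟨w', rfl⟩ := mem_range_lTensor_of_exact_baseChange (V := V) hj hjV hV hδ 0
    (key m 0 (by omega)) hw
  change (δ 0).lTensor N ((δ 1).lTensor N w') = 0
  rw [← LinearMap.comp_apply, ← LinearMap.lTensor_comp, (hδ 0).linearMap_comp_eq_zero]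
  simp

end Complex

/-! ### The augmented resolution of R/N and the conclusion -/

section Augmented

variable {R : Type u} [CommRing R] {M : Type u} [AddCommGroup M] [Module R M] {n : ℕ}

/-- The terms of a flat resolution, augmented by the resolved module in degree `0`. -/
def FlatResolution.augmented (F : FlatResolution R M n) : ℕ → ModuleCat.{u} R
  | 0 => ModuleCat.of R M
  | i + 1 => F.F i

/-- The differentials of the augmented resolution. -/
def FlatResolution.augmentedD (F : FlatResolution R M n) :
    ∀ i, F.augmented (i + 1) →ₗ[R] F.augmented i
  | 0 => F.aug
  | i + 1 => F.d i

theorem FlatResolution.exact_augmentedD (F : FlatResolution R M n) :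
    ∀ i, Function.Exact (F.augmentedD (i + 1)) (F.augmentedD i)
  | 0 => F.exact_zero
  | i + 1 => F.exact_succ i

end Augmented

/-- If `N² = 0` and `R / N` is a valuation domain, then `R / N` has no finite flat resolution unless
`N = 0`. -/
theorem isEmpty_flatResolution_quotient {R : Type u} [CommRing R] {N : Ideal R} (hN : N ^ 2 = ⊥)
    (hN0 : N ≠ ⊥) [IsDomain (R ⧸ N)] [ValuationRing (R ⧸ N)] (n : ℕ) :
    IsEmpty (FlatResolution R (R ⧸ N) n) := by
  refine ⟨fun F ↦ ?_⟩
  have hmul : ∀ a ∈ N, ∀ b ∈ N, a * b = 0 := fun a ha b hb ↦ by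
    have := Ideal.mul_mem_mul ha hb
    rwa [← sq, hN] at this
  have htors : Module.IsTorsionBySet R N (N : Set R) := fun x a ↦ Subtype.ext (hmul _ a.2 _ x.2)
  let _ : Module (R ⧸ N) N := htors.module
  have : IsScalarTower R (R ⧸ N) N := htors.isScalarTower
  have : ∀ i, Module.Flat R (F.augmented (i + 1)) := F.flat
  have hjV : Function.Exact N.subtype (Algebra.linearMap R (R ⧸ N)) := fun x ↦ by
    simp [Ideal.Quotient.eq_zero_iff_mem]
  have hsub : Subsingleton (N ⊗[R] (R ⧸ N)) :=
    subsingleton_tensor_of_bounded_resolution (V := R ⧸ N) (A := fun i ↦ F.augmented i)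
      (δ := F.augmentedD) N.subtype_injective hjV
      Ideal.Quotient.mk_surjective F.exact_augmentedD F.aug_surjective
      (fun a x ↦ by
        obtain ⟨x, rfl⟩ := Ideal.Quotient.mk_surjective (I := N) x
        exact Ideal.Quotient.eq_zero_iff_mem.2 (N.mul_mem_right _ a.2))
      -- The augmentation shifts degrees by one.
      (n + 1) (fun
        | 0, h => by omega
        | i + 1, h => F.subsingleton_of_lt i (by omega))
  obtain ⟨x, hx, hx0⟩ := Submodule.exists_mem_ne_zero_of_ne_bot hN0
  -- The action map N ⊗ R/N → N sends x ⊗ 1 to x, so N ⊗ R/N = 0 would give x = 0.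
  have h0 := congrArg (TensorProduct.lift (LinearMap.mk₂ R (fun (a : N) (v : R ⧸ N) ↦ v • a)
    (fun a b v ↦ smul_add v a b) (fun r a v ↦ smul_comm v r a) (fun a v w ↦ add_smul v w a)
    (fun r a v ↦ smul_assoc r v a))) (Subsingleton.elim ((⟨x, hx⟩ : N) ⊗ₜ[R] (1 : R ⧸ N)) 0)
  rw [map_zero, TensorProduct.lift.tmul, LinearMap.mk₂_apply, one_smul] at h0
  exact hx0 (congrArg Subtype.val h0)

theorem mainTheorem2 (R : Type u) [CommRing R] [IsLocalRing R] (hG : IsGaussianRing R)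
    (hred : ¬ IsReduced R) (hN : nilradical R ^ 2 = ⊥) :
    weakGlobalDim R = ⊤ := by
  have hN0 : nilradical R ≠ ⊥ := fun h ↦ hred ⟨fun x hx ↦ by
    rw [← Submodule.mem_bot R, ← h]
    exact mem_nilradical.2 hx⟩
  have := hG.nilradical_isPrime
  have := hG.valuationRing_quotient_nilradical
  refine top_le_iff.1 (le_trans ?_ (le_iSup _ (ModuleCat.of R (R ⧸ nilradical R))))
  exact le_iInf₂ fun n ⟨F⟩ ↦ ((isEmpty_flatResolution_quotient hN hN0 n).false F).elim
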